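/- Let $\mathcal X$ and $\mathcal Y$ be complex Banach spaces, let $A$ be a closed, densely defined linear operator from $\operatorname{dom}A\subset\mathcal X$ to $\mathcal Y$, and let $B$ be a closed, densely defined linear operator from $\operatorname{dom}B\subset\mathcal Y$ to $\mathcal X$. The products $AB$ (in $\mathcal Y$) and $BA$ (in $\mathcal X$) are taken on their natural domains $\operatorname{dom}(AB)=\{y\in\operatorname{dom}B : By\in\operatorname{dom}A\}$ and $\operatorname{dom}(BA)=\{x\in\operatorname{dom}A : Ax\in\operatorname{dom}B\}$. For a linear operator $T$ in a Banach space, $\rho(T)$ is the set of $\lambda\in\mathbb C$ such that $T-\lambda$ maps $\operatorname{dom}T$ bijectively onto the space and has a bounded inverse. An operator is upper (lower) semi-Fredholm if its range is closed and its kernel is finite-dimensional (its range is closed and finite-codimensional), and Fredholm if it is both. Further, - $\sigma_{\rm ap}(T)$ is the set of $\lambda\in\mathbb C$ for which there are $x_n\in\operatorname{dom}T$ with $\|x_n\|=1$ and $(T-\lambda)x_n\to0$; - $\sigma_{\rm c}(T)$ is the set of $\lambda\in\mathbb C$ for which $T-\lambda$ is injective with dense range but not surjective; - $\sigma_{\rm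 r}(T)$ is the set of $\lambda\in\mathbb C$ for which $T-\lambda$ is injective and its range is not dense; - $\sigma_{\rm ess}(T)$ is the set of $\lambda\in\mathbb C$ for which $T-\lambda$ is not Fredholm. Suppose that $\rho(AB)$ and $\rho(BA)$ are non-empty. Then for every $\lambda\in\mathbb C\setminus\{0\}$: (i) $\operatorname{ran}(AB-\lambda)$ is closed if and only if $\operatorname{ran}(BA-\lambda)$ is closed; (ii) $\operatorname{ran}(AB-\lambda)$ is dense in $\mathcal Y$ if and only if $\operatorname{ran}(BA-\lambda)$ is dense in $\mathcal X$; (iii) $AB-\lambda$ is upper semi-Fredholm if and only if $BA-\lambda$ is upper semi-Fredholm; (iv) $AB-\lambda$ is lower semi-Fredholm if and only if $BA-\lambda$ is lower semi-Fredholm. In consequence, $$\sigma_{\rm ap}(AB)\setminus\{0\}=\sigma_{\rm ap}(BA)\setminus\{0\},\qquad \sigma_{\rm c}(AB)\setminus\{0\}=\sigma_{\rm c}(BA)\setminus\{0\},$$ $$\sigma_{\rm r}(AB)\setminus\{0\}=\sigma_{\rm r}(BA)\setminus\{0\},\qquad \sigma_{\rm ess}(AB)\setminus\{0\}=\sigma_{\rm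 ess}(BA)\setminus\{0\}.$$ -/

import Mathlib

namespace LinearPMap

section Product

variable {E F G : Type*} [AddCommGroup E] [Module ℂ E] [AddCommGroup F] [Module ℂ F]
  [AddCommGroup G] [Module ℂ G]

/-- The domain `{x ∈ dom S : S x ∈ dom T}` of the product `T S`. -/
def prodDomain (T : F →ₗ.[ℂ] G) (S : E →ₗ.[ℂ] F) : Submodule ℂ E :=
  (T.domain.comap S.toFun).map S.domain.subtype

theorem mem_prodDomain (T : F →ₗ.[ℂ] G) (S : E →ₗ.[ℂ] F) (x : E) :
    x ∈ T.prodDomain S ↔ ∃ h : x ∈ S.domain, S ⟨x, h⟩ ∈ T.domain := by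
  simp [prodDomain]

theorem prodDomain_le (T : F →ₗ.[ℂ] G) (S : E →ₗ.[ℂ] F) : T.prodDomain S ≤ S.domain :=
  fun x hx => ((mem_prodDomain T S x).1 hx).1

/-- The product `T S` of two unbounded operators on its natural domain
`{x ∈ dom S : S x ∈ dom T}`, given there by `x ↦ T (S x)`. -/
def product (T : F →ₗ.[ℂ] G) (S : E →ₗ.[ℂ] F) : E →ₗ.[ℂ] G where
  domain := T.prodDomain S
  toFun := T.toFun ∘ₗ
    (S.toFun ∘ₗ Submodule.inclusion (prodDomain_le T S)).codRestrict T.domain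
      (fun x => ((mem_prodDomain T S x).1 x.2).2)

/-- The operator `T - z`, with the same domain as `T`. -/
def subScalar (T : E →ₗ.[ℂ] E) (z : ℂ) : E →ₗ.[ℂ] E where
  domain := T.domain
  toFun := T.toFun - z • T.domain.subtype

theorem product_apply (T : F →ₗ.[ℂ] G) (S : E →ₗ.[ℂ] F) (x : E) (hx : x ∈ S.domain)
    (hSx : S ⟨x, hx⟩ ∈ T.domain) :
    T.product S ⟨x, (mem_prodDomain T S x).2 ⟨hx, hSx⟩⟩ = T ⟨S ⟨x, hx⟩, hSx⟩ := rfl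

theorem subScalar_apply (T : E →ₗ.[ℂ] E) (z : ℂ) (x : T.domain) :
    T.subScalar z x = T x - z • (x : E) := rfl

/-- The kernel of `T`, as a subspace of its domain. -/
def kernel (T : E →ₗ.[ℂ] F) : Submodule ℂ T.domain := LinearMap.ker T.toFun

/-- The range of `T`. -/
def ran (T : E →ₗ.[ℂ] F) : Submodule ℂ F := LinearMap.range T.toFun

end Product

section Spectra

variable {E F : Type*} [NormedAddCommGroup E] [NormedSpace ℂ E]
  [NormedAddCommGroup F] [NormedSpace ℂ F]

/-- The resolvent set: `T - z` maps `dom T` bijectively onto the space, and its inverse is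
a bounded operator. -/
def resolventSet (T : E →ₗ.[ℂ] E) : Set ℂ :=
  {z | Function.Bijective (T.subScalar z) ∧
    ∃ R : E →L[ℂ] E, ∀ x : T.domain, R (T.subScalar z x) = x}

/-- The approximate point spectrum. -/
def approxPointSpectrum (T : E →ₗ.[ℂ] E) : Set ℂ :=
  {z | ∃ x : ℕ → T.domain, (∀ n, ‖(x n : E)‖ = 1) ∧
    Filter.Tendsto (fun n => T.subScalar z (x n)) Filter.atTop (nhds 0)}

/-- The continuous spectrum: `T - z` is injective with dense range, but not surjective. -/
def continuousSpectrum (T : E →ₗ.[ℂ] E) : Set ℂ :=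
  {z | (T.subScalar z).kernel = ⊥ ∧ Dense ((T.subScalar z).ran : Set E) ∧
    (T.subScalar z).ran ≠ ⊤}

/-- The residual spectrum: `T - z` is injective, but its range is not dense. -/
def residualSpectrum (T : E →ₗ.[ℂ] E) : Set ℂ :=
  {z | (T.subScalar z).kernel = ⊥ ∧ ¬ Dense ((T.subScalar z).ran : Set E)}

/-- Closed range and finite-dimensional kernel. -/
def IsUpperSemiFredholm (T : E →ₗ.[ℂ] F) : Prop :=
  _root_.IsClosed (T.ran : Set F) ∧ FiniteDimensional ℂ T.kernel

/-- Closed range of finite codimension. -/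
def IsLowerSemiFredholm (T : E →ₗ.[ℂ] F) : Prop :=
  _root_.IsClosed (T.ran : Set F) ∧ FiniteDimensional ℂ (F ⧸ T.ran)

/-- Both upper and lower semi-Fredholm. -/
def IsFredholmOperator (T : E →ₗ.[ℂ] F) : Prop :=
  T.IsUpperSemiFredholm ∧ T.IsLowerSemiFredholm

/-- The essential spectrum: all `z` for which `T - z` is not Fredholm. -/
def essentialSpectrum (T : E →ₗ.[ℂ] E) : Set ℂ :=
  {z | ¬ (T.subScalar z).IsFredholmOperator}

end Spectra

end LinearPMap

namespace LinearPMap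

/-! ### Graph calculus for products, and comparison of kernels. -/

section Graph

variable {E F G : Type*} [AddCommGroup E] [Module ℂ E] [AddCommGroup F] [Module ℂ F]
  [AddCommGroup G] [Module ℂ G]

/-! Fix `μ ∈ ρ(AB)`, `ν ∈ ρ(BA)` and set `R = (AB - μ)⁻¹`, `K = BR`, `L = A(BA - ν)⁻¹`; `K` and `L`
are bounded by the closed graph theorem. For `z ≠ 0`, `ran (AB - z)` is the preimage of `ran (BA -
z)` under `(z - μ)K` (`IsProductResolvent.mem_ran_iff`). So closedness pulls back, and the induced
map of quotients is injective, which transfers finite codimension. Density transfers because `(z -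
ν)L ∘ (z - μ)K` acts as `z` modulo `ran (AB - z)` (`smul_sub_mem_ran`). Kernels are compared by `B`
itself, and `exists_bound` carries lower bounds across. Each transfer is used twice, with `A` and
`B` exchanged. -/

theorem mem_graph_product_iff (T : F →ₗ.[ℂ] G) (S : E →ₗ.[ℂ] F) (x : E) (w : G) :
    (x, w) ∈ (T.product S).graph ↔ ∃ y, (x, y) ∈ S.graph ∧ (y, w) ∈ T.graph := by
  constructor
  · intro h
    obtain ⟨⟨u, hu⟩, rfl, rfl⟩ := (mem_graph_iff _).1 h
    obtain ⟨h₁, h₂⟩ := (mem_prodDomain T S u).1 hu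
    exact ⟨S ⟨u, h₁⟩, S.mem_graph ⟨u, h₁⟩, T.mem_graph ⟨S ⟨u, h₁⟩, h₂⟩⟩
  · rintro ⟨y, hxy, hyw⟩
    obtain ⟨⟨u, hu⟩, rfl, rfl⟩ := (mem_graph_iff _).1 hxy
    obtain ⟨⟨v, hv⟩, hvu, rfl⟩ := (mem_graph_iff _).1 hyw
    dsimp only at hvu
    subst hvu
    exact (T.product S).mem_graph ⟨u, (mem_prodDomain T S u).2 ⟨hu, hv⟩⟩

theorem mem_graph_subScalar_iff (T : E →ₗ.[ℂ] E) (z : ℂ) (x w : E) :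
    (x, w) ∈ (T.subScalar z).graph ↔ (x, w + z • x) ∈ T.graph := by
  constructor
  · intro h
    obtain ⟨u, rfl, rfl⟩ := (mem_graph_iff _).1 h
    change ((u : E), T u - z • (u : E) + z • (u : E)) ∈ T.graph
    rw [sub_add_cancel]
    exact T.mem_graph u
  · intro h
    obtain ⟨u, rfl, hu⟩ := (mem_graph_iff _).1 h
    dsimp only at hu
    refine (mem_graph_iff _).2 ⟨u, rfl, ?_⟩
    rw [subScalar_apply, hu, add_sub_cancel_right]

theorem mem_ran_iff (T : E →ₗ.[ℂ] F) (w : F) : w ∈ T.ran ↔ ∃ x, (x, w) ∈ T.graph := by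
  constructor
  · rintro ⟨x, rfl⟩
    exact ⟨x, T.mem_graph x⟩
  · rintro ⟨x, h⟩
    obtain ⟨u, -, hu⟩ := (mem_graph_iff _).1 h
    exact ⟨u, hu⟩

theorem mem_ran_product_subScalar_iff (A : E →ₗ.[ℂ] F) (B : F →ₗ.[ℂ] E) (z : ℂ) (y : F) :
    y ∈ ((A.product B).subScalar z).ran ↔
      ∃ u x, (u, x) ∈ B.graph ∧ (x, y + z • u) ∈ A.graph := by
  simp only [mem_ran_iff, mem_graph_subScalar_iff, mem_graph_product_iff]

theorem add_mem_graph {T : E →ₗ.[ℂ] F} {x x' : E} {y y' : F} (h : (x, y) ∈ T.graph)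
    (h' : (x', y') ∈ T.graph) : (x + x', y + y') ∈ T.graph :=
  T.graph.add_mem h h'

theorem smul_mem_graph {T : E →ₗ.[ℂ] F} {x : E} {y : F} (c : ℂ) (h : (x, y) ∈ T.graph) :
    (c • x, c • y) ∈ T.graph :=
  T.graph.smul_mem c h

theorem sub_mem_graph {T : E →ₗ.[ℂ] F} {x x' : E} {y y' : F} (h : (x, y) ∈ T.graph)
    (h' : (x', y') ∈ T.graph) : (x - x', y - y') ∈ T.graph :=
  T.graph.sub_mem h h'

/-- The kernel of `T`, as a subspace of the ambient space, is `{x : (x, 0) ∈ graph T}`. -/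
theorem mem_map_kernel_iff (T : E →ₗ.[ℂ] F) (x : E) :
    x ∈ T.kernel.map T.domain.subtype ↔ (x, 0) ∈ T.graph := by
  rw [mem_graph_iff]
  simp only [Submodule.mem_map, kernel, LinearMap.mem_ker, Submodule.subtype_apply]
  exact exists_congr fun u => and_comm

theorem mem_map_kernel_product_iff (A : E →ₗ.[ℂ] F) (B : F →ₗ.[ℂ] E) (z : ℂ) (y : F) :
    y ∈ ((A.product B).subScalar z).kernel.map ((A.product B).subScalar z).domain.subtype ↔
      ∃ x, (y, x) ∈ B.graph ∧ (x, z • y) ∈ A.graph := by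
  rw [mem_map_kernel_iff, mem_graph_subScalar_iff, mem_graph_product_iff, zero_add]

/-- For `z ≠ 0`, the operator `B` embeds the kernel of `AB - z` into that of `BA - z`. -/
theorem exists_injective_kernel (A : E →ₗ.[ℂ] F) (B : F →ₗ.[ℂ] E) {z : ℂ} (hz : z ≠ 0) :
    ∃ f : ((A.product B).subScalar z).kernel →ₗ[ℂ] ((B.product A).subScalar z).kernel,
      Function.Injective f := by
  set M := ((A.product B).subScalar z).kernel.map ((A.product B).subScalar z).domain.subtype
    with hM
  set N := ((B.product A).subScalar z).kernel.map ((B.product A).subScalar z).domain.subtype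
    with hN
  have key : ∀ y ∈ M, ∃ x, (y, x) ∈ B.graph ∧ (x, z • y) ∈ A.graph := fun y hy =>
    (mem_map_kernel_product_iff A B z y).1 hy
  have hdom : M ≤ B.domain := fun y hy => by
    obtain ⟨x, hx, -⟩ := key y hy
    exact mem_domain_of_mem_graph hx
  have hg : ∀ y : M, ((y : F), B.toFun (Submodule.inclusion hdom y)) ∈ B.graph := fun y =>
    B.mem_graph (Submodule.inclusion hdom y)
  have hA : ∀ y : M, (B.toFun (Submodule.inclusion hdom y), z • (y : F)) ∈ A.graph := fun y => by
    obtain ⟨x, hx, hx'⟩ := key y y.2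
    rwa [mem_graph_snd_inj B (hg y) hx rfl]
  let g : M →ₗ[ℂ] N := (B.toFun ∘ₗ Submodule.inclusion hdom).codRestrict N fun y =>
    (mem_map_kernel_product_iff B A z _).2 ⟨z • (y : F), hA y, smul_mem_graph z (hg y)⟩
  have hginj : Function.Injective g := by
    rw [injective_iff_map_eq_zero]
    intro y hy
    have h0 : B.toFun (Submodule.inclusion hdom y) = 0 := congrArg Subtype.val hy
    have h1 := hA y
    -- If `By = 0` then `zy = A(By) = 0`.
    have h2 : z • (y : F) = 0 := mem_graph_snd_inj A h1 A.graph.zero_mem h0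
    exact Subtype.ext ((smul_eq_zero.1 h2).resolve_left hz)
  let eM := Submodule.equivMapOfInjective ((A.product B).subScalar z).domain.subtype
    (Submodule.subtype_injective _) ((A.product B).subScalar z).kernel
  let eN := Submodule.equivMapOfInjective ((B.product A).subScalar z).domain.subtype
    (Submodule.subtype_injective _) ((B.product A).subScalar z).kernel
  exact ⟨eN.symm.toLinearMap ∘ₗ g ∘ₗ eM.toLinearMap,
    eN.symm.injective.comp (hginj.comp eM.injective)⟩

theorem finiteDimensional_kernel_product (A : E →ₗ.[ℂ] F) (B : F →ₗ.[ℂ] E) {z : ℂ} (hz : z ≠ 0)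
    (h : FiniteDimensional ℂ ((B.product A).subScalar z).kernel) :
    FiniteDimensional ℂ ((A.product B).subScalar z).kernel := by
  obtain ⟨f, hf⟩ := exists_injective_kernel A B hz
  exact FiniteDimensional.of_injective f hf

theorem kernel_product_eq_bot (A : E →ₗ.[ℂ] F) (B : F →ₗ.[ℂ] E) {z : ℂ} (hz : z ≠ 0)
    (h : ((B.product A).subScalar z).kernel = ⊥) : ((A.product B).subScalar z).kernel = ⊥ := by
  obtain ⟨f, hf⟩ := exists_injective_kernel A B hz
  refine (Submodule.eq_bot_iff _).2 fun x hx => ?_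
  have h0 : f ⟨x, hx⟩ = f 0 :=
    Subtype.ext (((Submodule.eq_bot_iff _).1 h _ (f ⟨x, hx⟩).2).trans (by simp))
  exact congrArg Subtype.val (hf h0)

end Graph

/-! ### Transfer of ranges and lower bounds through the resolvents. -/

section Resolvent

variable {X Y : Type*} [NormedAddCommGroup X] [NormedSpace ℂ X]
  [NormedAddCommGroup Y] [NormedSpace ℂ Y]

/-- `R` is the resolvent of `AB` at `μ` and `K = B R`, both being bounded operators. -/
structure IsProductResolvent (A : X →ₗ.[ℂ] Y) (B : Y →ₗ.[ℂ] X) (μ : ℂ) (R : Y →L[ℂ] Y)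
    (K : Y →L[ℂ] X) : Prop where
  left_mem : ∀ y, (R y, K y) ∈ B.graph
  right_mem : ∀ y, (K y, y + μ • R y) ∈ A.graph
  left_inv : ∀ {u x v}, (u, x) ∈ B.graph → (x, v) ∈ A.graph → R (v - μ • u) = u

/-- If `B` is closed, then `B (AB - μ)⁻¹` is bounded by the closed graph theorem. -/
theorem exists_isProductResolvent [CompleteSpace X] [CompleteSpace Y] (A : X →ₗ.[ℂ] Y)
    (B : Y →ₗ.[ℂ] X) (hB : B.IsClosed) {μ : ℂ} (hμ : μ ∈ (A.product B).resolventSet) :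
    ∃ R K, IsProductResolvent A B μ R K := by
  obtain ⟨⟨-, hsurj⟩, R, hR⟩ := hμ
  have hmem : ∀ y, (R y, y + μ • R y) ∈ (A.product B).graph := fun y => by
    obtain ⟨x, rfl⟩ := hsurj y
    rw [hR x, ← mem_graph_subScalar_iff]
    exact ((A.product B).subScalar μ).mem_graph x
  have hdom : ∀ y, R y ∈ B.domain := fun y => by
    obtain ⟨x, hx, -⟩ := (mem_graph_product_iff A B _ _).1 (hmem y)
    exact mem_domain_of_mem_graph hx
  let K₀ : Y →ₗ[ℂ] X := B.toFun ∘ₗ R.toLinearMap.codRestrict B.domain hdom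
  have hK₀ : ∀ y, (R y, K₀ y) ∈ B.graph := fun y => B.mem_graph ⟨R y, hdom y⟩
  have hcont : Continuous K₀ := by
    refine K₀.continuous_of_seq_closed_graph fun u x y hu hKu => ?_
    have hlim : Filter.Tendsto (fun n => (R (u n), K₀ (u n))) Filter.atTop (nhds (R x, y)) :=
      ((R.continuous.tendsto x).comp hu).prodMk_nhds hKu
    have hxy : (R x, y) ∈ B.graph :=
      _root_.IsClosed.mem_of_tendsto hB hlim (Filter.Eventually.of_forall fun n => hK₀ (u n))
    exact mem_graph_snd_inj B hxy (hK₀ x) rfl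
  refine ⟨R, ⟨K₀, hcont⟩, hK₀, fun y => ?_, fun {u x v} hux hxv => ?_⟩
  · obtain ⟨x, hx, hx'⟩ := (mem_graph_product_iff A B _ _).1 (hmem y)
    have : K₀ y = x := mem_graph_snd_inj B (hK₀ y) hx rfl
    change (K₀ y, _) ∈ _
    rwa [this]
  · have h : (u, v - μ • u) ∈ ((A.product B).subScalar μ).graph := by
      rw [mem_graph_subScalar_iff, sub_add_cancel, mem_graph_product_iff]
      exact ⟨x, hux, hxv⟩
    obtain ⟨w, rfl, hw⟩ := (mem_graph_iff _).1 h
    dsimp only at hw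
    rw [← hw]
    exact hR w

namespace IsProductResolvent

variable {A : X →ₗ.[ℂ] Y} {B : Y →ₗ.[ℂ] X} {μ ν : ℂ} {R : Y →L[ℂ] Y} {K : Y →L[ℂ] X}
  {S : X →L[ℂ] X} {L : X →L[ℂ] Y}

/-- The range of `AB - z` is the preimage of that of `BA - z` under `(z - μ) B (AB - μ)⁻¹`. -/
theorem mem_ran_iff (h : IsProductResolvent A B μ R K) {z : ℂ} (hz : z ≠ 0) (y : Y) :
    y ∈ ((A.product B).subScalar z).ran ↔
      ((z - μ) • K) y ∈ ((B.product A).subScalar z).ran := by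
  constructor
  · intro hy
    obtain ⟨u, x, hux, hxy⟩ := (mem_ran_product_subScalar_iff A B z y).1 hy
    -- Already `Ky = (BA - z)Ku` when `y = (AB - z)u`; the factor `z - μ` matters only for the
    -- converse.
    refine Submodule.smul_mem _ _ ?_
    refine (mem_ran_product_subScalar_iff B A z _).2 ⟨K u, u + μ • R u, h.right_mem u, ?_⟩
    have hu : R y + z • R u - μ • R u = u := by
      simpa using h.left_inv hux hxy
    have hu' : u + μ • R u = R y + z • R u := (sub_eq_iff_eq_add.1 hu).symm
    rw [hu']
    exact add_mem_graph (h.left_mem y) (smul_mem_graph z (h.left_mem u))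
  · intro hy
    obtain ⟨p, q, hpq, hq⟩ := (mem_ran_product_subScalar_iff B A z _).1 hy
    simp only [_root_.smul_apply] at hq
    -- With `q = Ap`, the preimage `u` is chosen so that `Bu = Ky + p`; then `ABu = y + μRy + q = y
    -- + zu`.
    refine (mem_ran_product_subScalar_iff A B z y).2
      ⟨R y + z⁻¹ • (q - (z - μ) • R y), K y + p, ?_, ?_⟩
    · convert add_mem_graph (h.left_mem y) (smul_mem_graph z⁻¹ (sub_mem_graph hq
        (smul_mem_graph (z - μ) (h.left_mem y)))) using 3
      rw [add_sub_cancel_left, inv_smul_smul₀ hz]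
    · convert add_mem_graph (h.right_mem y) hpq using 2
      rw [smul_add, smul_inv_smul₀ hz]
      module

theorem ran_eq_comap (h : IsProductResolvent A B μ R K) {z : ℂ} (hz : z ≠ 0) :
    ((A.product B).subScalar z).ran =
      ((B.product A).subScalar z).ran.comap ((z - μ) • K).toLinearMap :=
  Submodule.ext (h.mem_ran_iff hz)

theorem isClosed_ran (h : IsProductResolvent A B μ R K) {z : ℂ} (hz : z ≠ 0)
    (hcl : _root_.IsClosed (((B.product A).subScalar z).ran : Set X)) :
    _root_.IsClosed (((A.product B).subScalar z).ran : Set Y) := by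
  rw [h.ran_eq_comap hz]
  exact hcl.preimage ((z - μ) • K).continuous

theorem ran_eq_top (h : IsProductResolvent A B μ R K) {z : ℂ} (hz : z ≠ 0)
    (htop : ((B.product A).subScalar z).ran = ⊤) : ((A.product B).subScalar z).ran = ⊤ := by
  rw [h.ran_eq_comap hz, htop, Submodule.comap_top]

theorem finiteDimensional_quotient (h : IsProductResolvent A B μ R K) {z : ℂ} (hz : z ≠ 0)
    (hfin : FiniteDimensional ℂ (X ⧸ ((B.product A).subScalar z).ran)) :
    FiniteDimensional ℂ (Y ⧸ ((A.product B).subScalar z).ran) := by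
  refine FiniteDimensional.of_injective
    (Submodule.mapQ _ _ ((z - μ) • K).toLinearMap (h.ran_eq_comap hz).le) ?_
  rw [← LinearMap.ker_eq_bot, Submodule.ker_mapQ, ← h.ran_eq_comap hz, Submodule.mkQ_map_self]

/-- Modulo the range, the two comparison maps compose to multiplication by `z`, hence are mutually
inverse up to a nonzero scalar when `z ≠ 0`. -/
theorem smul_sub_mem_ran (h : IsProductResolvent A B μ R K) (h' : IsProductResolvent B A ν S L)
    (z : ℂ) (y : Y) :
    z • y - ((z - ν) • L) (((z - μ) • K) y) ∈ ((A.product B).subScalar z).ran := by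
  obtain ⟨x, hx⟩ : ∃ x, x = ((z - μ) • K) y := ⟨_, rfl⟩
  rw [← hx]
  simp only [_root_.smul_apply] at hx ⊢
  -- For `u = μRy + Lx`, the terms `μKy` and `x = (z - μ)Ky` in `Bu` add up to `zKy`.
  refine (mem_ran_product_subScalar_iff A B z _).2
    ⟨μ • R y + L x, z • K y + ν • S x, ?_, ?_⟩
  · convert add_mem_graph (smul_mem_graph μ (h.left_mem y)) (h'.right_mem x) using 2
    nth_rw 2 [hx]
    module
  · convert add_mem_graph (smul_mem_graph z (h.right_mem y))
      (smul_mem_graph ν (h'.left_mem x)) using 2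
    module

/-- Continuity of `L` sends the closure of `ran (BA - z)` into that of `ran (AB - z)`, so `zy` lies
in the latter for every `y`. -/
theorem dense_ran (h : IsProductResolvent A B μ R K) (h' : IsProductResolvent B A ν S L)
    {z : ℂ} (hz : z ≠ 0) (hd : Dense (((B.product A).subScalar z).ran : Set X)) :
    Dense (((A.product B).subScalar z).ran : Set Y) := by
  intro y
  have hmaps : Set.MapsTo ((z - ν) • L) (((B.product A).subScalar z).ran : Set X)
      (((A.product B).subScalar z).ran : Set Y) := fun x hx => (h'.mem_ran_iff hz x).1 hx
  have hy := hmaps.closure ((z - ν) • L).continuous (hd (((z - μ) • K) y))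
  rw [← Submodule.topologicalClosure_coe] at hy ⊢
  have hsum := Submodule.add_mem _
    (Submodule.le_topologicalClosure _ (h.smul_sub_mem_ran h' z y)) hy
  rw [sub_add_cancel] at hsum
  exact (Submodule.smul_mem_iff _ hz).1 hsum

/-- For `z ≠ 0`, a lower bound for `BA - z` yields one for `AB - z`. -/
theorem exists_bound (h : IsProductResolvent A B μ R K) (h' : IsProductResolvent B A ν S L)
    {z : ℂ} (hz : z ≠ 0) {C : ℝ}
    (hC : ∀ x w, (x, w) ∈ ((B.product A).subScalar z).graph → ‖x‖ ≤ C * ‖w‖) :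
    ∃ D : ℝ, ∀ u f, (u, f) ∈ ((A.product B).subScalar z).graph → ‖u‖ ≤ D * ‖f‖ := by
  -- The lower bound applies to `(BA - z)Ku = Kf`. To recover `u = Rf + (z - μ)Ru`, solve for `Ru`
  -- in `L(Kf + (z - ν)Ku) = AKu = Rf + zRu`.
  have hbound : ∀ u f, (u, f) ∈ ((A.product B).subScalar z).graph →
      ‖K u‖ ≤ C * ‖K f‖ ∧
        u = R f + ((z - μ) * z⁻¹) • (L (K f + (z - ν) • K u) - R f) := by
    intro u f huf
    rw [mem_graph_subScalar_iff, mem_graph_product_iff] at huf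
    obtain ⟨x, hux, hxf⟩ := huf
    have hu : R f + z • R u - μ • R u = u := by simpa using h.left_inv hux hxf
    have hu' : u + μ • R u = R f + z • R u := (sub_eq_iff_eq_add.1 hu).symm
    have hAKu := h.right_mem u
    rw [hu'] at hAKu
    have hBKu := add_mem_graph (h.left_mem f) (smul_mem_graph z (h.left_mem u))
    refine ⟨hC _ _ ?_, ?_⟩
    · rw [mem_graph_subScalar_iff, mem_graph_product_iff]
      exact ⟨_, hAKu, hBKu⟩
    · have hS := h'.left_inv hAKu hBKu
      have hL : L (K f + z • K u - ν • K u) = R f + z • R u :=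
        mem_graph_snd_inj A (h'.left_mem _) hAKu hS
      rw [sub_smul, ← add_sub_assoc, hL, add_sub_cancel_left, mul_smul, inv_smul_smul₀ hz,
        sub_smul, ← add_sub_assoc, hu]
  -- `|C|` appears since `C` has no assumed sign.
  refine ⟨‖R‖ + ‖(z - μ) * z⁻¹‖ * (‖L‖ * (‖K‖ + ‖z - ν‖ * (|C| * ‖K‖)) + ‖R‖), fun u f huf => ?_⟩
  obtain ⟨h₁, h₂⟩ := hbound u f huf
  have hKf := K.le_opNorm f
  have hRf := R.le_opNorm f
  have hKu : ‖K u‖ ≤ |C| * (‖K‖ * ‖f‖) :=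
    h₁.trans (mul_le_mul (le_abs_self C) hKf (norm_nonneg _) (abs_nonneg _))
  have hLx : ‖L (K f + (z - ν) • K u)‖ ≤
      ‖L‖ * (‖K‖ * ‖f‖ + ‖z - ν‖ * (|C| * (‖K‖ * ‖f‖))) := by
    refine (L.le_opNorm _).trans ?_
    gcongr
    refine (norm_add_le _ _).trans ?_
    rw [norm_smul]
    gcongr
  calc ‖u‖ = ‖R f + ((z - μ) * z⁻¹) • (L (K f + (z - ν) • K u) - R f)‖ := congrArg norm h₂
    _ ≤ ‖R f‖ + ‖(z - μ) * z⁻¹‖ * (‖L (K f + (z - ν) • K u)‖ + ‖R f‖) := by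
      refine (norm_add_le _ _).trans ?_
      rw [norm_smul]
      gcongr
      exact norm_sub_le _ _
    _ ≤ ‖R‖ * ‖f‖ + ‖(z - μ) * z⁻¹‖ *
        (‖L‖ * (‖K‖ * ‖f‖ + ‖z - ν‖ * (|C| * (‖K‖ * ‖f‖))) + ‖R‖ * ‖f‖) := by
      gcongr
    _ = _ := by ring

end IsProductResolvent

/-! ### Approximate point spectrum. -/

/-- `z` lies outside the approximate point spectrum iff `T - z` is bounded below. -/
theorem notMem_approxPointSpectrum_iff (T : X →ₗ.[ℂ] X) (z : ℂ) :
    z ∉ T.approxPointSpectrum ↔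
      ∃ C : ℝ, ∀ x w, (x, w) ∈ (T.subScalar z).graph → ‖x‖ ≤ C * ‖w‖ := by
  constructor
  · contrapose!
    intro hC
    have hseq : ∀ n : ℕ, ∃ x : T.domain, ‖(x : X)‖ = 1 ∧ ‖T.subScalar z x‖ ≤ 1 / ((n : ℝ) + 1) := by
      intro n
      obtain ⟨x, w, hxw, hlt⟩ := hC ((n : ℝ) + 1)
      obtain ⟨u, rfl, rfl⟩ := (mem_graph_iff _).1 hxw
      have hn : (0 : ℝ) < (n : ℝ) + 1 := by positivity
      have hpos : 0 < ‖(u : X)‖ := lt_of_le_of_lt (by positivity) hlt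
      -- Normalizing a violator of the bound with constant `n + 1` gives the approximate
      -- eigenvector.
      refine ⟨((‖(u : X)‖⁻¹ : ℝ) : ℂ) • u, ?_, ?_⟩
      · rw [Submodule.coe_smul, norm_smul, Complex.norm_real, norm_inv, norm_norm]
        exact inv_mul_cancel₀ hpos.ne'
      · have hmap : T.subScalar z (((‖(u : X)‖⁻¹ : ℝ) : ℂ) • u) =
            ((‖(u : X)‖⁻¹ : ℝ) : ℂ) • T.subScalar z u := (T.subScalar z).map_smul _ u
        rw [hmap, norm_smul, Complex.norm_real, norm_inv, norm_norm, le_div_iff₀ hn,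
          mul_assoc, inv_mul_le_iff₀ hpos, mul_one, mul_comm]
        exact hlt.le
    choose x hx₁ hx₂ using hseq
    exact ⟨x, hx₁, squeeze_zero_norm hx₂ tendsto_one_div_add_atTop_nhds_zero_nat⟩
  · rintro ⟨C, hC⟩ ⟨x, hx₁, hx₂⟩
    have hlim : Filter.Tendsto (fun n => C * ‖T.subScalar z (x n)‖) Filter.atTop (nhds 0) := by
      simpa using hx₂.norm.const_mul C
    have hle : (1 : ℝ) ≤ 0 := ge_of_tendsto hlim (Filter.Eventually.of_forall fun n =>
      (hx₁ n).symm.le.trans (hC _ _ ((T.subScalar z).mem_graph (x n))))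
    exact absurd hle (by norm_num)

theorem IsProductResolvent.notMem_approxPointSpectrum {A : X →ₗ.[ℂ] Y} {B : Y →ₗ.[ℂ] X}
    {μ ν : ℂ} {R : Y →L[ℂ] Y} {K : Y →L[ℂ] X} {S : X →L[ℂ] X} {L : X →L[ℂ] Y}
    (h : IsProductResolvent A B μ R K) (h' : IsProductResolvent B A ν S L) {z : ℂ} (hz : z ≠ 0)
    (hap : z ∉ (B.product A).approxPointSpectrum) : z ∉ (A.product B).approxPointSpectrum := by
  rw [notMem_approxPointSpectrum_iff] at hap ⊢
  obtain ⟨C, hC⟩ := hap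
  exact h.exists_bound h' hz hC

end Resolvent

end LinearPMap

/-! ### The main theorem. -/

theorem theoremp {X Y : Type*}
    [NormedAddCommGroup X] [NormedSpace ℂ X] [CompleteSpace X]
    [NormedAddCommGroup Y] [NormedSpace ℂ Y] [CompleteSpace Y]
    (A : X →ₗ.[ℂ] Y) (B : Y →ₗ.[ℂ] X)
    (hA : A.IsClosed) (hAd : Dense (A.domain : Set X))
    (hB : B.IsClosed) (hBd : Dense (B.domain : Set Y))
    (hAB : (A.product B).resolventSet.Nonempty)
    (hBA : (B.product A).resolventSet.Nonempty) :
    (∀ z : ℂ, z ≠ 0 →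
      (IsClosed (((A.product B).subScalar z).ran : Set Y) ↔
        IsClosed (((B.product A).subScalar z).ran : Set X)) ∧
      (Dense (((A.product B).subScalar z).ran : Set Y) ↔
        Dense (((B.product A).subScalar z).ran : Set X)) ∧
      (((A.product B).subScalar z).IsUpperSemiFredholm ↔
        ((B.product A).subScalar z).IsUpperSemiFredholm) ∧
      (((A.product B).subScalar z).IsLowerSemiFredholm ↔
        ((B.product A).subScalar z).IsLowerSemiFredholm)) ∧
    (A.product B).approxPointSpectrum \ {0} = (B.product A).approxPointSpectrum \ {0} ∧
    (A.product B).continuousSpectrum \ {0} = (B.product A).continuousSpectrum \ {0} ∧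
    (A.product B).residualSpectrum \ {0} = (B.product A).residualSpectrum \ {0} ∧
    (A.product B).essentialSpectrum \ {0} = (B.product A).essentialSpectrum \ {0} := by
  obtain ⟨μ, hμ⟩ := hAB
  obtain ⟨ν, hν⟩ := hBA
  obtain ⟨R, K, h⟩ := LinearPMap.exists_isProductResolvent A B hB hμ
  obtain ⟨S, L, h'⟩ := LinearPMap.exists_isProductResolvent B A hA hν
  have hcl : ∀ z : ℂ, z ≠ 0 → (IsClosed (((A.product B).subScalar z).ran : Set Y) ↔
      IsClosed (((B.product A).subScalar z).ran : Set X)) := fun z hz =>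
    ⟨h'.isClosed_ran hz, h.isClosed_ran hz⟩
  have hd : ∀ z : ℂ, z ≠ 0 → (Dense (((A.product B).subScalar z).ran : Set Y) ↔
      Dense (((B.product A).subScalar z).ran : Set X)) := fun z hz =>
    ⟨h'.dense_ran h hz, h.dense_ran h' hz⟩
  have hup : ∀ z : ℂ, z ≠ 0 → (((A.product B).subScalar z).IsUpperSemiFredholm ↔
      ((B.product A).subScalar z).IsUpperSemiFredholm) := fun z hz =>
    and_congr (hcl z hz) ⟨LinearPMap.finiteDimensional_kernel_product B A hz,
      LinearPMap.finiteDimensional_kernel_product A B hz⟩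
  have hlow : ∀ z : ℂ, z ≠ 0 → (((A.product B).subScalar z).IsLowerSemiFredholm ↔
      ((B.product A).subScalar z).IsLowerSemiFredholm) := fun z hz =>
    and_congr (hcl z hz) ⟨h'.finiteDimensional_quotient hz, h.finiteDimensional_quotient hz⟩
  have hker : ∀ z : ℂ, z ≠ 0 → (((A.product B).subScalar z).kernel = ⊥ ↔
      ((B.product A).subScalar z).kernel = ⊥) := fun z hz =>
    ⟨LinearPMap.kernel_product_eq_bot B A hz, LinearPMap.kernel_product_eq_bot A B hz⟩
  have htop : ∀ z : ℂ, z ≠ 0 → (((A.product B).subScalar z).ran = ⊤ ↔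
      ((B.product A).subScalar z).ran = ⊤) := fun z hz =>
    ⟨h'.ran_eq_top hz, h.ran_eq_top hz⟩
  have hdiff : ∀ s t : Set ℂ, (∀ z : ℂ, z ≠ 0 → (z ∈ s ↔ z ∈ t)) → s \ {0} = t \ {0} :=
    fun s t hst => Set.ext fun z => and_congr_left fun hz => hst z hz
  refine ⟨fun z hz => ⟨hcl z hz, hd z hz, hup z hz, hlow z hz⟩, hdiff _ _ fun z hz => ?_,
    hdiff _ _ fun z hz => ?_, hdiff _ _ fun z hz => ?_, hdiff _ _ fun z hz => ?_⟩
  · exact not_iff_not.1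
      ⟨h'.notMem_approxPointSpectrum h hz, h.notMem_approxPointSpectrum h' hz⟩
  · exact and_congr (hker z hz) (and_congr (hd z hz) (not_congr (htop z hz)))
  · exact and_congr (hker z hz) (not_congr (hd z hz))
  · exact not_congr (and_congr (hup z hz) (hlow z hz))
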